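/- Let $F:\mathbb{R}\to\mathbb{R}$ be nondecreasing. A real number $x$ is a point of growth of $F$ if $F(x-\varepsilon)<F(x+\varepsilon)$ for every $\varepsilon>0$. A sequence $\{s_k\}_{k=0}^\infty$ of positive numbers is the moment sequence of $F$ if for every $k\ge 0$ the Lebesgue–Stieltjes integral $\int_{-\infty}^{\infty}t^k\,dF(t)$ converges absolutely and equals $s_k$. A sequence of positive numbers is called a Hamburger moment sequence if it is the moment sequence of some nondecreasing function $F:\mathbb{R}\to\mathbb{R}$ having infinitely many points of growth. (i) Every sequence $\{s_k\}_{k=0}^\infty$ of positive numbers satisfying $$s_{n-1}s_{n+1}\ge 4s_n^2\qquad (n=1,2,3,\ldots)$$ is a Hamburger moment sequence. (ii) The constant $4$ in (i) cannot be improved: for every real $c<4$ there exists a sequence $\{s_k\}_{k=0}^\infty$ of positive numbers with $s_{n-1}s_{n+1}\ge c\,s_n^2$ for all $n\ge 1$ that is not a Hamburger moment sequence. -/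

import Mathlib

/-- The real sequence `s` is the moment sequence of the nondecreasing function `F : ℝ → ℝ`:
for every `k` the integral `∫ t ^ k dF(t)` over the real line converges (absolutely) and equals
`s k`.  Here `dF` is the Lebesgue-Stieltjes measure of `F`; `F` need not be right-continuous, so
the measure is formed from its right-continuous modification. -/
def IsMomentSequenceOf (s : ℕ → ℝ) (F : ℝ → ℝ) : Prop :=
  ∃ hF : Monotone F, ∀ k : ℕ,
    MeasureTheory.Integrable (fun t : ℝ => t ^ k) hF.stieltjesFunction.measure ∧
      ∫ t : ℝ, t ^ k ∂hF.stieltjesFunction.measure = s k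

/-- `x` is a point of growth of `F`: the function `F` increases strictly across every
neighbourhood of `x`. -/
def IsPointOfGrowth (F : ℝ → ℝ) (x : ℝ) : Prop :=
  ∀ ε : ℝ, 0 < ε → F (x - ε) < F (x + ε)

/-- Hamburger moment sequence: a sequence of positive numbers that is the moment sequence of a
nondecreasing function having infinitely many points of growth. -/
def IsHamburgerMomentSequence (s : ℕ → ℝ) : Prop :=
  (∀ k : ℕ, 0 < s k) ∧
    ∃ F : ℝ → ℝ, IsMomentSequenceOf s F ∧ {x : ℝ | IsPointOfGrowth F x}.Infinite

/-! For (i), let `D k m` be the determinant of the size-`k` Hankel matrix starting at `s m`, and let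
`R k m = D k m * D k (m+2) / D k (m+1) ^ 2`. Condensation expresses `D (k+1)` through `D k` and `D
(k-1)`, and yields inductively `R k ≥ (k+1)^2`, together with growth of `R k` by the factor
`((k+1)/k)^2` from one order to the next (`condensation_step`). The hypothesis is the case `k = 1`.
So all determinants are positive, the Hankel forms are positive definite, each truncated problem has
a discrete solution (`exists_nodes_weights`), and a weak limit of these solves the full problem.
Definiteness excludes finite support.

For (ii), after scaling by powers of a large `B`, the Hankel form of `alternatingRatioSeq` is nearly
tridiagonal, with diagonal `1` and neighbours `1 / d`. On an alternating vector it is about `M * (1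
- 2 / d)`, negative when `d < 2`, whereas a moment sequence gives the integral of a square. -/

/-! ### Positivity of Hankel determinants -/

open Matrix in
/-- The Desnanot-Jacobi identity, for a bordered invertible matrix. -/
theorem Matrix.det_fromBlocks_fin_two_mul_det {n : Type*} [Fintype n] [DecidableEq n]
    (A : Matrix n n ℝ) (B : Matrix n (Fin 2) ℝ) (C : Matrix (Fin 2) n ℝ)
    (D : Matrix (Fin 2) (Fin 2) ℝ) (hA : A.det ≠ 0) :
    let M (p q : Fin 2) : ℝ := (fromBlocks A (B.submatrix id fun _ : Unit => q)
      (C.submatrix (fun _ : Unit => p) id) (D.submatrix (fun _ => p) fun _ => q)).det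
    (fromBlocks A B C D).det * A.det = M 0 0 * M 1 1 - M 0 1 * M 1 0 := by
  intro M
  have := A.invertibleOfIsUnitDet (isUnit_iff_ne_zero.mpr hA)
  have hM (p q : Fin 2) : M p q = A.det * (D - C * ⅟A * B) p q := by
    simp only [M, det_fromBlocks₁₁, det_unique]
    rfl
  rw [hM, hM, hM, hM, det_fromBlocks₁₁, det_fin_two]
  ring

/-- The Hankel matrix `(s (m + i + j))` of size `k`. -/
def hankel (s : ℕ → ℝ) (m k : ℕ) : Matrix (Fin k) (Fin k) ℝ :=
  Matrix.of fun i j => s (m + i + j)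

/-- `Fin (k + 1)` as `Fin k` and the additional element `0`. -/
def finSumUnitZero (k : ℕ) : Fin k ⊕ Unit ≃ Fin (k + 1) where
  toFun := Sum.elim Fin.succ fun _ => 0
  invFun := Fin.cases (Sum.inr ()) Sum.inl
  left_inv x := by rcases x with x | x <;> simp
  right_inv x := by cases x using Fin.cases <;> simp

/-- `Fin (k + 1)` as `Fin k` and the additional element `k`. -/
def finSumUnitLast (k : ℕ) : Fin k ⊕ Unit ≃ Fin (k + 1) where
  toFun := Sum.elim Fin.castSucc fun _ => Fin.last k
  invFun := Fin.lastCases (Sum.inr ()) Sum.inl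
  left_inv x := by rcases x with x | x <;> simp
  right_inv x := by cases x using Fin.lastCases <;> simp

/-- `Fin (k + 2)` as its interior and its two extreme elements. -/
noncomputable def finSumFinTwo (k : ℕ) : Fin k ⊕ Fin 2 ≃ Fin (k + 2) :=
  Equiv.ofBijective (Sum.elim (fun i => i.succ.castSucc) ![0, Fin.last (k + 1)]) <| by
    refine (Fintype.bijective_iff_injective_and_card _).2 ⟨?_, by simp⟩
    rintro (x | x) (y | y) h
    · simpa using h
    · fin_cases y <;> simp [Fin.ext_iff] at h
      omega
    · fin_cases x <;> simp [Fin.ext_iff] at h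
      omega
    · fin_cases x <;> fin_cases y <;> simp_all [Fin.ext_iff]

/-- Border the interior block by the first and last indices. The two mixed minors are transposes of
each other, so their product is a square and the sign from reindexing rows and columns differently
is harmless. -/
theorem hankel_condensation (s : ℕ → ℝ) (m k : ℕ) (h : (hankel s (m + 2) k).det ≠ 0) :
    (hankel s m (k + 2)).det * (hankel s (m + 2) k).det =
      (hankel s m (k + 1)).det * (hankel s (m + 2) (k + 1)).det -
        (hankel s (m + 1) (k + 1)).det ^ 2 := by
  have key := Matrix.det_fromBlocks_fin_two_mul_det (hankel s (m + 2) k)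
    (Matrix.of fun i j => s (m + (i + 1) + ![0, k + 1] j))
    (Matrix.of fun i j => s (m + ![0, k + 1] i + (j + 1)))
    (Matrix.of fun i j => s (m + ![0, k + 1] i + ![0, k + 1] j)) h
  have h00 := Matrix.det_submatrix_equiv_self (finSumUnitZero k) (hankel s m (k + 1))
  have h11 := Matrix.det_submatrix_equiv_self (finSumUnitLast k) (hankel s (m + 2) (k + 1))
  have h01 := Matrix.abs_det_submatrix_equiv_equiv (finSumUnitZero k) (finSumUnitLast k)
    (hankel s (m + 1) (k + 1))
  have h10 := Matrix.det_transpose ((hankel s (m + 1) (k + 1)).submatrix (finSumUnitZero k)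
    (finSumUnitLast k))
  have htot := Matrix.det_submatrix_equiv_self (finSumFinTwo k) (hankel s m (k + 2))
  rw [← sq_abs (hankel s (m + 1) (k + 1)).det, ← h01, sq_abs, sq]
  nth_rewrite 2 [← h10]
  rw [← h00, ← h11, ← htot]
  refine Eq.trans ?_ (key.trans ?_)
  · congr 2
    ext i j
    rcases i with i | i <;> rcases j with j | j
    · simp [hankel, finSumFinTwo]; congr 1; ring
    · fin_cases j <;> simp [hankel, finSumFinTwo]
    · fin_cases i <;> simp [hankel, finSumFinTwo]
    · fin_cases i <;> fin_cases j <;> simp [hankel, finSumFinTwo]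
  · beta_reduce
    congr 1
    · congr 2 <;> ext (i | i) (j | j) <;> simp [hankel, finSumUnitZero, finSumUnitLast] <;>
        (congr 1; ring)
    · congr 2 <;> ext (i | i) (j | j) <;> simp [hankel, finSumUnitZero, finSumUnitLast] <;>
        (congr 1; ring)

/-- One condensation step, for `a = D (k-1)`, `b = D k`, `c = D (k+1)`. -/
theorem condensation_step {k : ℝ} (hk : 0 < k) {a b c : ℕ → ℝ}
    (ha : ∀ m, 0 < a m) (hb : ∀ m, 0 < b m)
    (hc : ∀ m, c m * a (m + 2) = b m * b (m + 2) - b (m + 1) ^ 2)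
    (hR : ∀ m, (k + 1) ^ 2 * b (m + 1) ^ 2 ≤ b m * b (m + 2))
    (hR1 : ∀ m, ((k + 1) / k) ^ 2 * (a m * a (m + 2) / a (m + 1) ^ 2) ≤
      b m * b (m + 2) / b (m + 1) ^ 2)
    (hR2 : ∀ m, ((k + 1) / k) ^ 2 * (a (m + 2) * a (m + 4) / a (m + 3) ^ 2) ≤
      b m * b (m + 2) / b (m + 1) ^ 2) :
    (∀ m, 0 < c m) ∧
    (∀ m, (k + 2) ^ 2 * c (m + 1) ^ 2 ≤ c m * c (m + 2)) ∧
    (∀ m, ((k + 2) / (k + 1)) ^ 2 * (b m * b (m + 2) / b (m + 1) ^ 2) ≤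
      c m * c (m + 2) / c (m + 1) ^ 2) ∧
    (∀ m, ((k + 2) / (k + 1)) ^ 2 * (b (m + 2) * b (m + 4) / b (m + 3) ^ 2) ≤
      c m * c (m + 2) / c (m + 1) ^ 2) := by
  set R : ℕ → ℝ := fun m => b m * b (m + 2) / b (m + 1) ^ 2 with hRdef
  set Q : ℕ → ℝ := fun m => a m * a (m + 2) / a (m + 1) ^ 2 with hQdef
  have hQpos (m) : 0 < Q m := by have := ha m; have := ha (m + 1); have := ha (m + 2); positivity
  have hRge (m) : (k + 1) ^ 2 ≤ R m := by
    rw [hRdef, le_div_iff₀ (by have := hb (m + 1); positivity)]; exact hR m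
  have hR1' (m) : 1 < R m := lt_of_lt_of_le (by nlinarith) (hRge m)
  have hcR (m) : c m = (b (m + 1) ^ 2 / a (m + 2)) * (R m - 1) := by
    have h1 := (hb (m + 1)).ne'
    have h2 := (ha (m + 2)).ne'
    simp only [hRdef]
    field_simp
    linarith [hc m]
  have hcpos (m) : 0 < c m := by
    rw [hcR]
    have := hb (m + 1); have := ha (m + 2); have := hR1' m
    have : 0 < R m - 1 := by linarith
    positivity
  -- Dropping the subtracted square is affordable: this bound is used only for the denominator `c (m
  -- + 1) ^ 2`.
  have hcle (m) : c m ≤ b m * b (m + 2) / a (m + 2) := by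
    rw [le_div_iff₀ (ha _), hc]; nlinarith [sq_nonneg (b (m + 1))]
  have hratio (m) : (R m - 1) * (R (m + 2) - 1) / Q (m + 2) ≤ c m * c (m + 2) / c (m + 1) ^ 2 := by
    have e : (R m - 1) * (R (m + 2) - 1) / Q (m + 2) =
        c m * c (m + 2) / (b (m + 1) * b (m + 3) / a (m + 3)) ^ 2 := by
      rw [hcR m, hcR (m + 2)]
      have h1 := (hb (m + 1)).ne'
      have h2 := (ha (m + 2)).ne'
      have h3 := (hb (m + 3)).ne'
      have h4 := (ha (m + 3)).ne'
      have h5 := (ha (m + 4)).ne'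
      simp only [hQdef]
      field_simp
    rw [e]
    have := hcpos m; have := hcpos (m + 1); have := hcpos (m + 2)
    gcongr
    exact hcle (m + 1)
  -- The constant is `1 - 1 / (k + 1) ^ 2`, from `R m ≥ (k + 1) ^ 2`.
  have hsub (m) : (k * (k + 2) / (k + 1) ^ 2) * R m ≤ R m - 1 := by
    have h0 := hRge m
    rw [div_mul_eq_mul_div, div_le_iff₀ (by positivity)]
    nlinarith
  -- The square of the constant in `hsub` times `((k + 1) / k) ^ 2` is exactly `((k + 2) / (k + 1))
  -- ^ 2`, so the induction closes without loss. It is applied with `x = R m` and `x = R (m + 2)`.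
  have gen (m) (x : ℝ) (hx : R m * R (m + 2) ≥ ((k + 1) / k) ^ 2 * Q (m + 2) * x) :
      ((k + 2) / (k + 1)) ^ 2 * x ≤ c m * c (m + 2) / c (m + 1) ^ 2 := by
    refine le_trans ?_ (hratio m)
    rw [le_div_iff₀ (hQpos _)]
    have h1 := hR1' m
    have h2 := hR1' (m + 2)
    calc ((k + 2) / (k + 1)) ^ 2 * x * Q (m + 2)
        = (k * (k + 2) / (k + 1) ^ 2) ^ 2 * (((k + 1) / k) ^ 2 * Q (m + 2) * x) := by
          field_simp
      _ ≤ (k * (k + 2) / (k + 1) ^ 2) ^ 2 * (R m * R (m + 2)) := by gcongr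
      _ = ((k * (k + 2) / (k + 1) ^ 2) * R m) * ((k * (k + 2) / (k + 1) ^ 2) * R (m + 2)) := by ring
      _ ≤ (R m - 1) * (R (m + 2) - 1) := by
          exact mul_le_mul (hsub m) (hsub (m + 2)) (by positivity) (by linarith)
  have c1 (m) : ((k + 2) / (k + 1)) ^ 2 * R m ≤ c m * c (m + 2) / c (m + 1) ^ 2 := by
    apply gen
    have := mul_le_mul_of_nonneg_right (hR1 (m + 2)) (zero_le_one.trans (hR1' m).le)
    linarith
  have c2 (m) : ((k + 2) / (k + 1)) ^ 2 * R (m + 2) ≤ c m * c (m + 2) / c (m + 1) ^ 2 := by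
    apply gen
    have := mul_le_mul_of_nonneg_right (hR2 m) (zero_le_one.trans (hR1' (m + 2)).le)
    linarith
  refine ⟨hcpos, fun m => ?_, c1, c2⟩
  rw [← le_div_iff₀ (by have := hcpos (m + 1); positivity)]
  refine le_trans ?_ (c1 m)
  calc (k + 2) ^ 2 = ((k + 2) / (k + 1)) ^ 2 * (k + 1) ^ 2 := by field_simp
    _ ≤ _ := by gcongr; exact hRge m

theorem hankel_det_pos {s : ℕ → ℝ} (hs : ∀ n, 0 < s n)
    (h4 : ∀ n, 4 * s (n + 1) ^ 2 ≤ s n * s (n + 2)) (m k : ℕ) : 0 < (hankel s m k).det := by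
  have h0 (m) : (hankel s m 0).det = 1 := Matrix.det_isEmpty
  have h1 (m) : (hankel s m 1).det = s m := by simp [hankel]
  suffices H : ∀ k : ℕ, (∀ m, 0 < (hankel s m k).det) ∧ (∀ m, 0 < (hankel s m (k + 1)).det) ∧
      (∀ m, ((k + 1 : ℝ) + 1) ^ 2 * (hankel s (m + 1) (k + 1)).det ^ 2 ≤
        (hankel s m (k + 1)).det * (hankel s (m + 2) (k + 1)).det) ∧
      (∀ m, (((k + 1 : ℝ) + 1) / (k + 1)) ^ 2 * ((hankel s m k).det * (hankel s (m + 2) k).det /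
          (hankel s (m + 1) k).det ^ 2) ≤
        (hankel s m (k + 1)).det * (hankel s (m + 2) (k + 1)).det /
          (hankel s (m + 1) (k + 1)).det ^ 2) ∧
      (∀ m, (((k + 1 : ℝ) + 1) / (k + 1)) ^ 2 *
          ((hankel s (m + 2) k).det * (hankel s (m + 4) k).det / (hankel s (m + 3) k).det ^ 2) ≤
        (hankel s m (k + 1)).det * (hankel s (m + 2) (k + 1)).det /
          (hankel s (m + 1) (k + 1)).det ^ 2) from (H k).1 m
  intro k
  induction k with
  | zero =>
    have hr (m) : 4 ≤ s m * s (m + 2) / s (m + 1) ^ 2 := by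
      rw [le_div_iff₀ (by have := hs (m + 1); positivity)]; exact h4 m
    simp only [h0, h1, zero_add, Nat.cast_zero]
    refine ⟨fun _ => one_pos, hs, fun m => ?_, fun m => ?_, fun m => ?_⟩
    · linarith [h4 m]
    · linarith [hr m]
    · linarith [hr m]
  | succ k ih =>
    obtain ⟨ha, hb, hR, hR1, hR2⟩ := ih
    have := condensation_step (k := k + 1) (by positivity) ha hb
      (fun m => hankel_condensation s m k (ha (m + 2)).ne') hR hR1 hR2
    obtain ⟨i1, i2, i3, i4⟩ := this
    push_cast
    have e : (k + 1 + 1 + 1 : ℝ) = k + 1 + 2 := by ring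
    rw [e]
    exact ⟨hb, i1, i2, i3, i4⟩

/-! ### Positive definiteness -/

open Matrix in
/-- The inductive step of Sylvester's criterion. -/
theorem Matrix.posDef_fromBlocks_unit {n : Type*} [Fintype n] [DecidableEq n]
    {A : Matrix n n ℝ} (hA : A.PosDef) (B : Matrix n Unit ℝ) (D : Matrix Unit Unit ℝ)
    (hdet : 0 < (fromBlocks A B Bᴴ D).det) : (fromBlocks A B Bᴴ D).PosDef := by
  have := A.invertibleOfIsUnitDet (isUnit_iff_ne_zero.mpr hA.det_pos.ne')
  have h : (fromBlocks A B Bᴴ D).PosSemidef := by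
    rw [PosDef.fromBlocks₁₁ _ _ hA]
    rw [det_fromBlocks₁₁, det_unique (n := Unit), invOf_eq_nonsing_inv] at hdet
    have := pos_of_mul_pos_right hdet hA.det_pos.le
    have e : D - Bᴴ * A⁻¹ * B = diagonal fun _ => (D - Bᴴ * A⁻¹ * B) () () := by
      ext i j; simp
    rw [e]
    exact PosSemidef.diagonal fun _ => this.le
  rw [h.posDef_iff_isUnit, isUnit_iff_isUnit_det]
  exact isUnit_iff_ne_zero.mpr hdet.ne'

theorem hankel_posDef {s : ℕ → ℝ} (hs : ∀ n, 0 < s n)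
    (h4 : ∀ n, 4 * s (n + 1) ^ 2 ≤ s n * s (n + 2)) (k : ℕ) : (hankel s 0 k).PosDef := by
  induction k with
  | zero => exact ⟨Subsingleton.elim _ _, fun x hx => absurd (Subsingleton.elim _ _) hx⟩
  | succ k ih =>
    have hpos := hankel_det_pos hs h4 0 (k + 1)
    have e : hankel s 0 (k + 1) = (Matrix.fromBlocks (hankel s 0 k)
        (Matrix.of fun i _ => s (i + k)) (Matrix.of fun (i : Fin k) _ => s (i + k)).conjTranspose
        (Matrix.of fun _ _ => s (k + k))).submatrix (finSumUnitLast k).symm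
          (finSumUnitLast k).symm := by
      ext i j
      cases i using Fin.lastCases <;> cases j using Fin.lastCases <;>
        simp [hankel, finSumUnitLast, add_comm]
    rw [e, Matrix.det_submatrix_equiv_self] at hpos
    rw [e]
    exact (Matrix.posDef_fromBlocks_unit ih _ _ hpos).submatrix (Equiv.injective _)

/-! ### Discrete solutions of the truncated problem -/

open Matrix in
open scoped MatrixOrder ComplexOrder Matrix.Norms.L2Operator in
/-- Simultaneous diagonalisation of two real quadratic forms, one of them positive definite. -/
theorem Matrix.PosDef.exists_simultaneous_diagonalisation {n : Type*} [Fintype n] [DecidableEq n]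
    {H K : Matrix n n ℝ} (hH : H.PosDef) (hK : K.IsHermitian) :
    ∃ (W : Matrix n n ℝ) (l : n → ℝ), IsUnit W ∧ H = Wᴴ * W ∧ K = Wᴴ * diagonal l * W := by
  obtain ⟨B, hB, rfl⟩ := CStarAlgebra.isStrictlyPositive_iff_eq_star_mul_self.mp
    hH.isStrictlyPositive
  have hBd : IsUnit B.det := (isUnit_iff_isUnit_det B).mp hB
  have hBd' : IsUnit Bᴴ.det := by rwa [det_conjTranspose, star_trivial]
  have hA : (B⁻¹ᴴ * K * B⁻¹).IsHermitian := isHermitian_conjTranspose_mul_mul _ hK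
  set U : Matrix n n ℝ := hA.eigenvectorUnitary.1
  have hUU : U * Uᴴ = 1 := mem_unitaryGroup_iff.mp hA.eigenvectorUnitary.2
  have hspec : B⁻¹ᴴ * K * B⁻¹ = U * diagonal hA.eigenvalues * Uᴴ := hA.spectral_theorem
  have hUunit : IsUnit Uᴴ := IsUnit.of_mul_eq_one_right _ hUU
  refine ⟨Uᴴ * B, hA.eigenvalues, hUunit.mul hB, ?_, ?_⟩
  · rw [conjTranspose_mul, conjTranspose_conjTranspose, Matrix.mul_assoc, ← Matrix.mul_assoc U,
      hUU, Matrix.one_mul, star_eq_conjTranspose]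
  · calc K = Bᴴ * (B⁻¹ᴴ * K * B⁻¹) * B := by
          rw [conjTranspose_nonsing_inv, Matrix.mul_assoc, Matrix.mul_assoc, Matrix.mul_assoc,
            nonsing_inv_mul _ hBd, Matrix.mul_one, mul_nonsing_inv_cancel_left _ _ hBd']
      _ = Bᴴ * (U * diagonal hA.eigenvalues * Uᴴ) * B := congrArg (fun X => Bᴴ * X * B) hspec
      _ = _ := by
          rw [conjTranspose_mul, conjTranspose_conjTranspose]
          simp only [Matrix.mul_assoc]

-- Diagonalise the Hankel form together with its shift. The shift makes the columns of `W`
-- successive multiples by the nodes `l`, so row `i` of `W` is geometric and the first row of `Wᴴ *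
-- W` is a quadrature formula.
open Matrix in
theorem exists_nodes_weights {s : ℕ → ℝ} {n : ℕ} (h : (hankel s 0 (n + 1)).PosDef) :
    ∃ l w : Fin (n + 1) → ℝ, (∀ i, 0 ≤ w i) ∧ ∀ k ≤ n, ∑ i, w i * l i ^ k = s k := by
  have hK : (hankel s 1 (n + 1)).IsHermitian := by
    ext i j; simp [hankel, add_right_comm]
  obtain ⟨W, l, hW, hHW, hKW⟩ := h.exists_simultaneous_diagonalisation hK
  have hW' : IsUnit Wᴴ := hW.star
  -- Column `j + 1` of the Hankel matrix is column `j` of its shift; cancel `Wᴴ`.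
  have hstep (j : Fin n) (i) : W i j.succ = l i * W i j.castSucc := by
    have e : Wᴴ *ᵥ (fun i => W i j.succ) = Wᴴ *ᵥ (fun i => l i * W i j.castSucc) := by
      ext p
      have h1 := congrFun (congrFun hHW p) j.succ
      have h2 := congrFun (congrFun hKW p) j.castSucc
      rw [Matrix.mul_assoc, mul_apply] at h2
      rw [mul_apply] at h1
      simp only [diagonal_mul] at h2
      simp only [mulVec, dotProduct]
      rw [← h1, ← h2]
      simp only [hankel, of_apply, Fin.val_succ, Fin.val_castSucc]
      congr 1; ring
    exact congrFun (mulVec_injective_of_isUnit hW' e) i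
  have hpow (k : ℕ) (hk : k < n + 1) (i) : W i ⟨k, hk⟩ = l i ^ k * W i 0 := by
    induction k with
    | zero => simp
    | succ k ih =>
      have := hstep ⟨k, by omega⟩ i
      rw [Fin.succ_mk, Fin.castSucc_mk, ih] at this
      rw [this]; ring
  refine ⟨l, fun i => W i 0 ^ 2, fun i => sq_nonneg _, fun k hk => ?_⟩
  have h1 := congrFun (congrFun hHW 0) ⟨k, by omega⟩
  rw [mul_apply, hankel, of_apply, Fin.val_zero, zero_add, zero_add] at h1
  rw [h1]
  refine Finset.sum_congr rfl fun i _ => ?_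
  rw [conjTranspose_apply, star_trivial, hpow k (by omega) i]
  ring

open MeasureTheory in
theorem exists_probabilityMeasure_truncated_moments {s : ℕ → ℝ} (h0 : s 0 = 1) {n : ℕ}
    (h : (hankel s 0 (n + 1)).PosDef) :
    ∃ μ : ProbabilityMeasure ℝ, (∀ f : ℝ → ℝ, Integrable f (μ : Measure ℝ)) ∧
      ∀ k ≤ n, ∫ t, t ^ k ∂(μ : Measure ℝ) = s k := by
  obtain ⟨l, w, hw, hlw⟩ := exists_nodes_weights h
  have hint (f : ℝ → ℝ) (i : Fin (n + 1)) :
      Integrable f (ENNReal.ofReal (w i) • Measure.dirac (l i)) :=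
    (integrable_dirac (by simp)).smul_measure (by simp)
  refine ⟨⟨∑ i, ENNReal.ofReal (w i) • Measure.dirac (l i), ⟨?_⟩⟩, fun f => ?_, fun k hk => ?_⟩
  · have := hlw 0 (Nat.zero_le _)
    simp only [pow_zero, mul_one] at this
    simp only [Measure.coe_finsetSum, Finset.sum_apply, Measure.smul_apply, measure_univ,
      smul_eq_mul, mul_one]
    rw [← ENNReal.ofReal_sum_of_nonneg fun i _ => hw i, this, h0, ENNReal.ofReal_one]
  · rw [ProbabilityMeasure.coe_mk]
    exact integrable_finsetSum_measure.2 fun i _ => hint f i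
  · rw [ProbabilityMeasure.coe_mk, integral_finsetSum_measure fun i _ => hint _ i, ← hlw k hk]
    refine Finset.sum_congr rfl fun i _ => ?_
    rw [integral_smul_measure, integral_dirac, ENNReal.toReal_ofReal (hw i), smul_eq_mul]

/-! ### Passage to the weak limit -/

open MeasureTheory Filter Topology

/-- Truncation of a real number to `[-R, R]`. -/
def clip (R t : ℝ) : ℝ := max (-R) (min R t)

theorem continuous_clip (R : ℝ) : Continuous (clip R) := by
  unfold clip; fun_prop

theorem clip_eq_self {R t : ℝ} (h : |t| ≤ R) : clip R t = t := by
  rw [abs_le] at h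
  rw [clip, min_eq_right h.2, max_eq_right h.1]

theorem abs_clip_le {R : ℝ} (hR : 0 ≤ R) (t : ℝ) : |clip R t| ≤ R :=
  abs_le.2 ⟨le_max_left _ _, max_le (by linarith) (min_le_left _ _)⟩

theorem abs_clip_le_abs {R : ℝ} (hR : 0 ≤ R) (t : ℝ) : |clip R t| ≤ |t| := by
  rcases le_total |t| R with h | h
  · rw [clip_eq_self h]
  · exact (abs_clip_le hR t).trans h

/-- Where clipping acts, `R ≤ |t|` trades one power of `|t|` for `1 / R`. The even exponent makes
the error a moment, hence uniform along the approximating measures. -/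
theorem abs_pow_sub_clip_pow_le {R : ℝ} (hR : 1 ≤ R) (t : ℝ) (k : ℕ) :
    |t ^ k - clip R t ^ k| ≤ 2 / R * t ^ (2 * (k + 1)) := by
  have hR0 : 0 < R := by linarith
  have hpos : 0 ≤ t ^ (2 * (k + 1)) := by rw [pow_mul]; positivity
  rcases le_total |t| R with h | h
  · rw [clip_eq_self h, sub_self, abs_zero]
    positivity
  · have h1 : 1 ≤ |t| := hR.trans h
    calc |t ^ k - clip R t ^ k| ≤ |t| ^ k + |clip R t| ^ k := by
          rw [← abs_pow, ← abs_pow]; exact abs_sub _ _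
      _ ≤ |t| ^ k + |t| ^ k :=
          add_le_add le_rfl (pow_le_pow_left₀ (abs_nonneg _) (abs_clip_le_abs hR0.le t) k)
      _ = 2 / R * (R * |t| ^ k) := by field_simp; ring
      _ ≤ 2 / R * (|t| * |t| ^ k) := by gcongr
      _ ≤ 2 / R * |t| ^ (2 * (k + 1)) := by
          rw [← pow_succ']
          gcongr
          omega
      _ = 2 / R * t ^ (2 * (k + 1)) := by rw [(even_two_mul _).pow_abs]

theorem integrable_clip_pow (μ : Measure ℝ) [IsFiniteMeasure μ] {R : ℝ} (hR : 0 ≤ R) (k : ℕ) :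
    Integrable (fun t => clip R t ^ k) μ := by
  refine Integrable.of_bound ((continuous_clip R).pow k).aestronglyMeasurable (R ^ k)
    (Filter.Eventually.of_forall fun t => ?_)
  rw [Real.norm_eq_abs, abs_pow]
  exact pow_le_pow_left₀ (abs_nonneg _) (abs_clip_le hR t) k

theorem abs_integral_pow_sub_integral_clip_pow_le (μ : Measure ℝ) [IsFiniteMeasure μ]
    {R : ℝ} (hR : 1 ≤ R) {k : ℕ} (hk : Integrable (fun t : ℝ => t ^ k) μ)
    (hk2 : Integrable (fun t : ℝ => t ^ (2 * (k + 1))) μ) :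
    |∫ t, t ^ k ∂μ - ∫ t, clip R t ^ k ∂μ| ≤ 2 / R * ∫ t, t ^ (2 * (k + 1)) ∂μ := by
  rw [← integral_sub hk (integrable_clip_pow μ (by linarith) k), ← integral_const_mul]
  refine (abs_integral_le_integral_abs).trans
    (integral_mono_of_nonneg (Filter.Eventually.of_forall fun t => abs_nonneg _) (hk2.const_mul _)
      (Filter.Eventually.of_forall fun t => abs_pow_sub_clip_pow_le hR t k))

/-- Integration of clipped powers is continuous for weak convergence. -/
theorem tendsto_integral_clip_pow {ι : Type*} {U : Filter ι} {μ : ι → ProbabilityMeasure ℝ}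
    {ν : ProbabilityMeasure ℝ} (h : Tendsto μ U (𝓝 ν)) {R : ℝ} (hR : 0 ≤ R) (k : ℕ) :
    Tendsto (fun i => ∫ t, clip R t ^ k ∂(μ i : Measure ℝ)) U
      (𝓝 (∫ t, clip R t ^ k ∂(ν : Measure ℝ))) :=
  ProbabilityMeasure.tendsto_iff_forall_integral_tendsto.1 h
    (BoundedContinuousFunction.ofNormedAddCommGroup (fun t => clip R t ^ k)
      ((continuous_clip R).pow k) (R ^ k) fun t => by
        rw [Real.norm_eq_abs, abs_pow]
        exact pow_le_pow_left₀ (abs_nonneg _) (abs_clip_le hR t) k)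

/-- Fatou's lemma, as the clipping level tends to infinity. -/
theorem lintegral_even_pow_le (ν : Measure ℝ) [IsFiniteMeasure ν] (m : ℕ) (C : ℝ)
    (h : ∀ j : ℕ, ∫ t, clip j t ^ (2 * m) ∂ν ≤ C) :
    ∫⁻ t, ENNReal.ofReal (t ^ (2 * m)) ∂ν ≤ ENNReal.ofReal C := by
  have hlim (t : ℝ) : liminf (fun j : ℕ => ENNReal.ofReal (clip j t ^ (2 * m))) atTop =
      ENNReal.ofReal (t ^ (2 * m)) := by
    refine Tendsto.liminf_eq (tendsto_const_nhds.congr' ?_)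
    obtain ⟨N, hN⟩ := exists_nat_ge |t|
    filter_upwards [eventually_ge_atTop N] with j hj
    rw [clip_eq_self (hN.trans (by exact_mod_cast hj))]
  have hmeas (j : ℕ) : Measurable fun t : ℝ => ENNReal.ofReal (clip j t ^ (2 * m)) :=
    ENNReal.measurable_ofReal.comp ((continuous_clip j).pow _).measurable
  calc ∫⁻ t, ENNReal.ofReal (t ^ (2 * m)) ∂ν
      = ∫⁻ t, liminf (fun j : ℕ => ENNReal.ofReal (clip j t ^ (2 * m))) atTop ∂ν := by
        simp only [hlim]
    _ ≤ liminf (fun j : ℕ => ∫⁻ t, ENNReal.ofReal (clip j t ^ (2 * m)) ∂ν) atTop :=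
        lintegral_liminf_le hmeas
    _ ≤ liminf (fun _ : ℕ => ENNReal.ofReal C) atTop := by
        refine liminf_le_liminf (Eventually.of_forall fun j => ?_)
        rw [← ofReal_integral_eq_lintegral_ofReal (integrable_clip_pow ν j.cast_nonneg _)
          (Eventually.of_forall fun t => (even_two_mul m).pow_nonneg _)]
        exact ENNReal.ofReal_le_ofReal (h j)
    _ = ENNReal.ofReal C := liminf_const _

theorem exists_probabilityMeasure_moments_of_truncated {s : ℕ → ℝ}
    {μ : ℕ → ProbabilityMeasure ℝ}
    (hint : ∀ n, ∀ f : ℝ → ℝ, Integrable f (μ n : Measure ℝ))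
    (hmom : ∀ n, ∀ k ≤ n, ∫ t, t ^ k ∂(μ n : Measure ℝ) = s k) :
    ∃ ν : ProbabilityMeasure ℝ, ∀ k : ℕ, Integrable (fun t : ℝ => t ^ k) (ν : Measure ℝ) ∧
      ∫ t, t ^ k ∂(ν : Measure ℝ) = s k := by
  set u : ℕ → NNReal := fun n => (s 2).toNNReal / ((n : NNReal) + 1)
  have hu : Tendsto u atTop (𝓝 0) := by
    rw [← NNReal.tendsto_coe]
    simp only [u, NNReal.coe_div, NNReal.coe_add, NNReal.coe_natCast, NNReal.coe_one,
      NNReal.coe_zero]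
    exact tendsto_const_nhds.div_atTop
      (tendsto_natCast_atTop_atTop.atTop_add tendsto_const_nhds)
  have hcomp := isCompact_setOfPred_probabilityMeasure_mass_eq_compl_isCompact_le
    (E := ℝ) (u := u) (K := fun n => Metric.closedBall 0 ((n : ℝ) + 1)) hu
    (fun n => isCompact_closedBall _ _) (Or.inl inferInstance)
  -- Tightness by Markov's inequality for `t ^ 2`, whose integral is `s 2` once `n ≥ 2`.
  have hmem (n : ℕ) (hn : 2 ≤ n) : μ n ∈
      {μ : ProbabilityMeasure ℝ | ∀ n : ℕ, μ (Metric.closedBall 0 ((n : ℝ) + 1))ᶜ ≤ u n} := by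
    intro j
    have h1 := mul_meas_ge_le_integral_of_nonneg (μ := (μ n : Measure ℝ))
      (f := fun t => t ^ 2) (Eventually.of_forall fun t => sq_nonneg t) (hint n _) ((j : ℝ) + 1)
    rw [hmom n 2 hn] at h1
    have h2 : ((μ n) (Metric.closedBall 0 ((j : ℝ) + 1))ᶜ : ℝ) ≤
        (μ n : Measure ℝ).real {x | (j : ℝ) + 1 ≤ x ^ 2} := by
      refine measureReal_mono fun x hx => ?_
      have hx' : (j : ℝ) + 1 < |x| := by simpa using hx
      have hj : (0 : ℝ) ≤ j := j.cast_nonneg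
      change (j : ℝ) + 1 ≤ x ^ 2
      rw [← sq_abs]
      nlinarith
    rw [← NNReal.coe_le_coe]
    refine h2.trans ?_
    simp only [u, NNReal.coe_div, NNReal.coe_add, NNReal.coe_natCast, NNReal.coe_one]
    rw [le_div_iff₀ (by positivity), mul_comm]
    exact h1.trans (Real.le_coe_toNNReal _)
  have hUle : ((hyperfilter ℕ : Ultrafilter ℕ) : Filter ℕ) ≤ atTop := Nat.hyperfilter_le_atTop
  obtain ⟨ν, -, hν⟩ := hcomp.ultrafilter_le_nhds' (Ultrafilter.map μ (hyperfilter ℕ))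
    (hUle ((eventually_ge_atTop 2).mono hmem))
  have hT : Tendsto μ (hyperfilter ℕ : Ultrafilter ℕ) (𝓝 ν) := hν
  have heven_le (m j : ℕ) : ∫ t, clip j t ^ (2 * m) ∂(ν : Measure ℝ) ≤ s (2 * m) := by
    refine le_of_tendsto (tendsto_integral_clip_pow hT j.cast_nonneg (2 * m))
      (hUle ((eventually_ge_atTop (2 * m)).mono fun n hn => ?_))
    rw [← hmom n _ hn]
    refine integral_mono (integrable_clip_pow _ j.cast_nonneg _) (hint n _) fun t => ?_
    rw [← (even_two_mul m).pow_abs, ← (even_two_mul m).pow_abs t]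
    exact pow_le_pow_left₀ (abs_nonneg _) (abs_clip_le_abs j.cast_nonneg t) _
  have hlin (m : ℕ) := lintegral_even_pow_le (ν : Measure ℝ) m _ (heven_le m)
  have heven_int (m : ℕ) : Integrable (fun t : ℝ => t ^ (2 * m)) (ν : Measure ℝ) :=
    (lintegral_ofReal_ne_top_iff_integrable (by fun_prop)
      (Eventually.of_forall fun t => (even_two_mul m).pow_nonneg t)).1
      ((hlin m).trans_lt ENNReal.ofReal_lt_top).ne
  have hs_nonneg (m : ℕ) : 0 ≤ s (2 * m) := by
    rw [← hmom _ _ le_rfl]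
    exact integral_nonneg fun t => (even_two_mul m).pow_nonneg t
  have heven (m : ℕ) : ∫ t, t ^ (2 * m) ∂(ν : Measure ℝ) ≤ s (2 * m) := by
    rw [← ENNReal.ofReal_le_ofReal_iff (hs_nonneg m), ofReal_integral_eq_lintegral_ofReal
      (heven_int m) (Eventually.of_forall fun t => (even_two_mul m).pow_nonneg t)]
    exact hlin m
  have hint_ν (k : ℕ) : Integrable (fun t : ℝ => t ^ k) (ν : Measure ℝ) := by
    refine ((integrable_const (1 : ℝ)).add (heven_int k)).mono' (by fun_prop)
      (Eventually.of_forall fun t => ?_)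
    rw [Real.norm_eq_abs, Pi.add_apply, mul_comm 2 k, pow_mul, ← sq_abs (t ^ k)]
    nlinarith [sq_nonneg (|t ^ k| - 1), abs_nonneg (t ^ k)]
  refine ⟨ν, fun k => ⟨hint_ν k, ?_⟩⟩
  -- Compare both sides with the clipped moment of `ν`; each comparison costs `2 / R` times an even
  -- moment bound.
  have hbound (R : ℝ) (hR : 1 ≤ R) :
      |∫ t, t ^ k ∂(ν : Measure ℝ) - s k| ≤ 4 * s (2 * (k + 1)) / R := by
    have h1 := (abs_integral_pow_sub_integral_clip_pow_le (ν : Measure ℝ) hR (hint_ν k)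
      (hint_ν _)).trans (mul_le_mul_of_nonneg_left (heven (k + 1)) (by positivity))
    have h2 : |∫ t, clip R t ^ k ∂(ν : Measure ℝ) - s k| ≤ 2 / R * s (2 * (k + 1)) := by
      refine le_of_tendsto (((tendsto_integral_clip_pow hT (by linarith) k).sub_const _).abs)
        (hUle ((eventually_ge_atTop (2 * (k + 1))).mono fun n hn => ?_))
      rw [← hmom n _ hn, ← hmom n k (by omega), abs_sub_comm]
      exact abs_integral_pow_sub_integral_clip_pow_le _ hR (hint n _) (hint n _)
    calc _ ≤ _ := abs_sub_le _ (∫ t, clip R t ^ k ∂(ν : Measure ℝ)) _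
      _ ≤ _ := add_le_add h1 h2
      _ = _ := by ring
  have hlim : Tendsto (fun R : ℝ => 4 * s (2 * (k + 1)) / R) atTop (𝓝 0) :=
    tendsto_const_nhds.div_atTop tendsto_id
  have := ge_of_tendsto hlim ((eventually_ge_atTop 1).mono hbound)
  exact sub_eq_zero.1 (abs_nonpos_iff.1 this)

/-! ### Infinitely many points of growth -/

theorem integral_sq_sum_eq {s : ℕ → ℝ} {μ : Measure ℝ}
    (h : ∀ k : ℕ, Integrable (fun t : ℝ => t ^ k) μ ∧ ∫ t, t ^ k ∂μ = s k) (N : ℕ) (a : ℕ → ℝ) :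
    ∫ t, (∑ i ∈ Finset.range N, a i * t ^ i) ^ 2 ∂μ =
      ∑ i ∈ Finset.range N, ∑ j ∈ Finset.range N, a i * a j * s (i + j) := by
  have e (t : ℝ) : (∑ i ∈ Finset.range N, a i * t ^ i) ^ 2 =
      ∑ i ∈ Finset.range N, ∑ j ∈ Finset.range N, a i * a j * t ^ (i + j) := by
    rw [sq, Finset.sum_mul_sum]
    exact Finset.sum_congr rfl fun i _ => Finset.sum_congr rfl fun j _ => by ring
  simp only [e]
  have hi (i j : ℕ) : Integrable (fun t : ℝ => a i * a j * t ^ (i + j)) μ := (h _).1.const_mul _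
  rw [integral_finsetSum _ fun i _ => integrable_finsetSum _ fun j _ => hi i j]
  refine Finset.sum_congr rfl fun i _ => ?_
  rw [integral_finsetSum _ fun j _ => hi i j]
  exact Finset.sum_congr rfl fun j _ => by rw [integral_const_mul, (h _).2]

/-- A measure with positive definite Hankel matrices is not carried by a finite set. -/
theorem measure_compl_ne_zero_of_finite {s : ℕ → ℝ} {μ : Measure ℝ}
    (h : ∀ k : ℕ, Integrable (fun t : ℝ => t ^ k) μ ∧ ∫ t, t ^ k ∂μ = s k)
    (hpd : ∀ n, (hankel s 0 n).PosDef) (Z : Finset ℝ) : μ (Z : Set ℝ)ᶜ ≠ 0 := by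
  intro hZ
  -- If `μ` lived on `Z`, then `p ^ 2` would integrate to zero, contradicting definiteness at the
  -- coefficient vector of `p`.
  set p : Polynomial ℝ := ∏ x ∈ Z, (Polynomial.X - Polynomial.C x) with hp
  have hmonic : p.Monic := Polynomial.monic_prod_of_monic _ _ fun x _ => Polynomial.monic_X_sub_C x
  have hzero : ∫ t, (∑ i ∈ Finset.range (p.natDegree + 1), p.coeff i * t ^ i) ^ 2 ∂μ = 0 := by
    refine integral_eq_zero_of_ae ?_
    filter_upwards [compl_mem_ae_iff.2 hZ] with t ht
    rw [compl_compl, Finset.mem_coe] at ht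
    rw [← Polynomial.eval_eq_sum_range, hp, Polynomial.eval_prod, Finset.prod_eq_zero ht (by simp)]
    simp
  rw [integral_sq_sum_eq h] at hzero
  have hv : (fun i : Fin (p.natDegree + 1) => p.coeff i) ≠ 0 := fun h0 => by
    have := congrFun h0 (Fin.last _)
    simp [hmonic.coeff_natDegree] at this
  have hpos := (hpd (p.natDegree + 1)).dotProduct_mulVec_pos hv
  refine hpos.ne' (Eq.trans ?_ hzero)
  simp only [dotProduct, Matrix.mulVec, star_trivial, hankel, Matrix.of_apply, zero_add,
    Finset.sum_range, Finset.mul_sum]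
  exact Finset.sum_congr rfl fun i _ => Finset.sum_congr rfl fun j _ => by ring

theorem StieltjesFunction.measure_compl_isPointOfGrowth (G : StieltjesFunction ℝ) :
    G.measure {x | IsPointOfGrowth G x}ᶜ = 0 := by
  refine measure_null_of_locally_null _ fun x hx => ?_
  obtain ⟨ε, hε, h⟩ : ∃ ε : ℝ, 0 < ε ∧ G (x + ε) ≤ G (x - ε) := by
    simpa [IsPointOfGrowth] using hx
  refine ⟨Set.Ioc (x - ε) (x + ε), mem_nhdsWithin_of_mem_nhds
    (Ioc_mem_nhds (by linarith) (by linarith)), ?_⟩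
  rw [G.measure_Ioc, ENNReal.ofReal_eq_zero]
  linarith

theorem isHamburgerMomentSequence_of_four_mul_sq_le {s : ℕ → ℝ} (hs : ∀ n, 0 < s n)
    (h4 : ∀ n, 4 * s (n + 1) ^ 2 ≤ s n * s (n + 2)) : IsHamburgerMomentSequence s := by
  have hs0 := hs 0
  have hpd (n : ℕ) : (hankel (fun k => s k / s 0) 0 n).PosDef := by
    refine hankel_posDef (fun n => div_pos (hs n) hs0) (fun n => ?_) n
    rw [div_pow, div_mul_div_comm, mul_div_assoc', ← sq]
    exact div_le_div_of_nonneg_right (h4 n) (by positivity)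
  choose μ hint hmom using fun n =>
    exists_probabilityMeasure_truncated_moments (div_self hs0.ne') (hpd (n + 1))
  obtain ⟨ν, hν⟩ := exists_probabilityMeasure_moments_of_truncated hint hmom
  obtain ⟨c, hc⟩ : ∃ c : NNReal, (c : ℝ) = s 0 := ⟨⟨s 0, hs0.le⟩, rfl⟩
  have hc0 : c ≠ 0 := fun h => hs0.ne' (by rw [← hc, h, NNReal.coe_zero])
  -- The moments were normalised to total mass one; the factor `c = s 0` undoes this.
  set G : StieltjesFunction ℝ := c • ProbabilityTheory.cdf ν with hG
  have hGmeas : G.measure = c • (ν : Measure ℝ) := by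
    rw [hG, StieltjesFunction.measure_smul, ProbabilityTheory.measure_cdf]
  have hGG : G.mono.stieltjesFunction = G := by
    ext x
    rw [Monotone.stieltjesFunction_eq, G.rightLim_eq]
  refine ⟨hs, G, ⟨G.mono, fun k => ?_⟩, fun hfin => ?_⟩
  · rw [hGG, hGmeas]
    refine ⟨(hν k).1.smul_measure_nnreal, ?_⟩
    rw [integral_smul_nnreal_measure, (hν k).2, NNReal.smul_def, hc, smul_eq_mul,
      mul_div_cancel₀ _ hs0.ne']
  · refine measure_compl_ne_zero_of_finite hν hpd hfin.toFinset ?_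
    have := G.measure_compl_isPointOfGrowth
    rw [hGmeas, Measure.smul_apply] at this
    rw [hfin.coe_toFinset]
    exact (smul_eq_zero.1 this).resolve_left hc0

/-! ### Sharpness of the constant -/

/-- A positive sequence whose ratios `s (n - 1) * s (n + 1) / s n ^ 2` alternate between
`d ^ 2` and `B ^ 2 / d ^ 2`. -/
noncomputable def alternatingRatioSeq (B d : ℝ) (k : ℕ) : ℝ :=
  B ^ ((k ^ 2 + 1) / 2) / if Even k then 1 else d

theorem alternatingRatioSeq_two_mul (B d : ℝ) (i : ℕ) :
    alternatingRatioSeq B d (2 * i) = B ^ (2 * i ^ 2) := by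
  have : ((2 * i) ^ 2 + 1) / 2 = 2 * i ^ 2 := by
    rw [show (2 * i) ^ 2 = 2 * (2 * i ^ 2) by ring]; omega
  simp [alternatingRatioSeq, this]

theorem alternatingRatioSeq_two_mul_add_one (B d : ℝ) (i : ℕ) :
    alternatingRatioSeq B d (2 * i + 1) = B ^ (2 * i ^ 2 + 2 * i + 1) / d := by
  have : ((2 * i + 1) ^ 2 + 1) / 2 = 2 * i ^ 2 + 2 * i + 1 := by
    rw [show (2 * i + 1) ^ 2 = 2 * (2 * i ^ 2 + 2 * i) + 1 by ring]; omega
  simp [alternatingRatioSeq, this]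

theorem alternatingRatioSeq_pos {B d : ℝ} (hB : 0 < B) (hd : 0 < d) (k : ℕ) :
    0 < alternatingRatioSeq B d k := by
  unfold alternatingRatioSeq
  split_ifs <;> positivity

theorem mul_alternatingRatioSeq_sq_le {B d : ℝ} (hd : 1 ≤ d) (hB : d ^ 2 ≤ B) (n : ℕ) :
    d ^ 2 * alternatingRatioSeq B d (n + 1) ^ 2 ≤
      alternatingRatioSeq B d n * alternatingRatioSeq B d (n + 2) := by
  have hd0 : 0 < d := by linarith
  rcases Nat.even_or_odd' n with ⟨i, rfl | rfl⟩
  · rw [alternatingRatioSeq_two_mul_add_one, alternatingRatioSeq_two_mul,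
      show 2 * i + 2 = 2 * (i + 1) by ring, alternatingRatioSeq_two_mul]
    apply le_of_eq
    field_simp
    ring
  · rw [show 2 * i + 1 + 1 = 2 * (i + 1) by ring, show 2 * i + 1 + 2 = 2 * (i + 1) + 1 by ring,
      alternatingRatioSeq_two_mul_add_one, alternatingRatioSeq_two_mul_add_one,
      alternatingRatioSeq_two_mul, div_mul_div_comm, le_div_iff₀ (by positivity)]
    have hB0 : 0 ≤ B := (sq_nonneg d).trans hB
    have h1 : d ^ 2 * d ^ 2 ≤ B ^ 2 := by rw [sq B]; gcongr
    calc d ^ 2 * (B ^ (2 * (i + 1) ^ 2)) ^ 2 * (d * d)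
        = d ^ 2 * d ^ 2 * (B ^ (2 * (i + 1) ^ 2)) ^ 2 := by ring
      _ ≤ B ^ 2 * (B ^ (2 * (i + 1) ^ 2)) ^ 2 := by gcongr
      _ = _ := by ring

/-- The scaled entry has size about `B ^ (-(i - j) ^ 2 / 2)`. Rounding in the exponent makes it
exactly `1 / d` for neighbours; farther apart it is at most `1 / B`. -/
theorem alternatingRatioSeq_term_le {B d : ℝ} (hd : 1 ≤ d) (hB : 1 ≤ B) (i j : ℕ) :
    (-1) ^ i / B ^ i ^ 2 * ((-1) ^ j / B ^ j ^ 2) * alternatingRatioSeq B d (i + j) ≤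
      (if j = i then 1 else 0) - (if j = i + 1 then 1 / d else 0) -
        (if i = j + 1 then 1 / d else 0) + 1 / B := by
  have hd0 : 0 < d := by linarith
  have hB0 : 0 < B := by linarith
  have hBi : 0 ≤ 1 / B := by positivity
  have adj (i : ℕ) : (-1) ^ i / B ^ i ^ 2 * ((-1) ^ (i + 1) / B ^ (i + 1) ^ 2) *
      alternatingRatioSeq B d (i + (i + 1)) = -(1 / d) := by
    rw [show i + (i + 1) = 2 * i + 1 by ring, alternatingRatioSeq_two_mul_add_one,
      div_mul_div_comm, ← pow_add, ← pow_add, show i + (i + 1) = 2 * i + 1 by ring,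
      show i ^ 2 + (i + 1) ^ 2 = 2 * i ^ 2 + 2 * i + 1 by ring, pow_succ, pow_mul]
    norm_num
    field_simp
  rcases eq_or_ne j i with rfl | h0
  · rw [if_pos rfl, if_neg (by simp), ← two_mul, alternatingRatioSeq_two_mul,
      div_mul_div_comm, ← pow_add, ← pow_add, ← two_mul, ← two_mul, pow_mul]
    norm_num
    rw [inv_mul_cancel₀ (by positivity)]
    linarith [inv_nonneg.2 hB0.le]
  rcases eq_or_ne j (i + 1) with rfl | h1
  · rw [if_neg h0, if_pos rfl, if_neg (by omega), adj]
    linarith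
  rcases eq_or_ne i (j + 1) with rfl | h2
  · rw [if_neg h0, if_neg h1, if_pos rfl, mul_comm ((-1) ^ (j + 1) / _), add_comm (j + 1) j, adj]
    linarith
  rw [if_neg h0, if_neg h1, if_neg h2, sub_zero, sub_zero, zero_add]
  have hexp : ((i + j) ^ 2 + 1) / 2 + 1 ≤ i ^ 2 + j ^ 2 := by
    have h3 : (i + j) ^ 2 + 4 ≤ 2 * (i ^ 2 + j ^ 2) := by
      rcases lt_or_gt_of_ne h0 with h | h
      · obtain ⟨m, rfl⟩ : ∃ m, i = j + 2 + m := ⟨i - j - 2, by omega⟩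
        nlinarith
      · obtain ⟨m, rfl⟩ : ∃ m, j = i + 2 + m := ⟨j - i - 2, by omega⟩
        nlinarith
    omega
  have hseq : alternatingRatioSeq B d (i + j) ≤ B ^ (((i + j) ^ 2 + 1) / 2) := by
    refine div_le_self (by positivity) ?_
    split_ifs
    · exact le_rfl
    · exact hd
  have hsign (k : ℕ) : |(-1 : ℝ) ^ k| = 1 := by simp
  refine (le_abs_self _).trans ?_
  rw [abs_mul, abs_mul, abs_div, abs_div, hsign, hsign,
    abs_of_pos (alternatingRatioSeq_pos hB0 hd0 _), abs_of_pos (pow_pos hB0 _),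
    abs_of_pos (pow_pos hB0 _), div_mul_div_comm, one_mul, ← pow_add, div_mul_eq_mul_div, one_mul,
    div_le_div_iff₀ (by positivity) hB0, one_mul]
  calc _ ≤ B ^ (((i + j) ^ 2 + 1) / 2) * B := by gcongr
    _ = B ^ (((i + j) ^ 2 + 1) / 2 + 1) := (pow_succ _ _).symm
    _ ≤ _ := pow_le_pow_right₀ hB hexp

theorem alternatingRatioSeq_quadraticForm_le {B d : ℝ} (hd : 1 ≤ d) (hB : 1 ≤ B) (M : ℕ) :
    ∑ i ∈ Finset.range (M + 1), ∑ j ∈ Finset.range (M + 1),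
      (-1) ^ i / B ^ i ^ 2 * ((-1) ^ j / B ^ j ^ 2) * alternatingRatioSeq B d (i + j) ≤
      (M + 1) - 2 * (M / d) + (M + 1) ^ 2 / B := by
  refine (Finset.sum_le_sum fun i _ => Finset.sum_le_sum fun j _ =>
    alternatingRatioSeq_term_le hd hB i j).trans (le_of_eq ?_)
  have key : ∑ i ∈ Finset.range (M + 1), ∑ j ∈ Finset.range (M + 1),
      (if j = i + 1 then 1 / d else 0) = M / d := by
    rw [Finset.sum_range_succ, Finset.sum_congr rfl (g := fun _ => 1 / d)]
    · simp
      ring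
    · intro i hi
      rw [Finset.sum_ite_eq', if_pos (by simpa using hi)]
  have key' : ∑ i ∈ Finset.range (M + 1), ∑ j ∈ Finset.range (M + 1),
      (if i = j + 1 then 1 / d else 0) = M / d := by
    rw [Finset.sum_comm, key]
  have diag : ∑ i ∈ Finset.range (M + 1), ∑ j ∈ Finset.range (M + 1),
      (if j = i then (1 : ℝ) else 0) = M + 1 := by
    rw [Finset.sum_congr rfl (g := fun _ => 1)]
    · simp
    · intro i hi
      rw [Finset.sum_ite_eq', if_pos hi]
  simp only [Finset.sum_add_distrib, Finset.sum_sub_distrib, key, key', diag]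
  simp
  ring

theorem exists_not_isHamburgerMomentSequence {c : ℝ} (hc : c < 4) :
    ∃ s : ℕ → ℝ, (∀ n, 0 < s n) ∧ (∀ n, c * s (n + 1) ^ 2 ≤ s n * s (n + 2)) ∧
      ¬ IsHamburgerMomentSequence s := by
  -- The maximum covers small or negative `c` while keeping `1 ≤ d < 2`.
  set d : ℝ := √(max c 1) with hd_def
  have hd : 1 ≤ d := Real.one_le_sqrt.2 (le_max_right _ _)
  have hd0 : 0 < d := by linarith
  have hdsq : d ^ 2 = max c 1 := Real.sq_sqrt (by positivity)
  have hd2 : d < 2 := by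
    have : max c 1 < 4 := max_lt hc (by norm_num)
    nlinarith
  have hδ : 0 < 2 / d - 1 := by rw [sub_pos, lt_div_iff₀ hd0]; linarith
  -- The gain `M * (2 / d - 1)` must exceed `2`: one unit for the extra diagonal term, one for the
  -- error `(M + 1) ^ 2 / B`.
  obtain ⟨M, hM⟩ := exists_nat_gt (2 / (2 / d - 1))
  rw [div_lt_iff₀ hδ] at hM
  set B : ℝ := d ^ 2 + (M + 1) ^ 2 with hB_def
  have hBd : d ^ 2 ≤ B := by rw [hB_def]; nlinarith
  have hB : 1 ≤ B := by nlinarith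
  have hMB : ((M : ℝ) + 1) ^ 2 / B ≤ 1 := by
    rw [div_le_one (by linarith), hB_def]; nlinarith
  refine ⟨alternatingRatioSeq B d, alternatingRatioSeq_pos (by linarith) hd0, fun n => ?_, ?_⟩
  · refine le_trans ?_ (mul_alternatingRatioSeq_sq_le hd hBd n)
    gcongr
    rw [hdsq]
    exact le_max_left _ _
  · rintro ⟨-, F, ⟨hF, hmom⟩, -⟩
    have h1 := integral_sq_sum_eq hmom (M + 1) fun i => (-1) ^ i / B ^ i ^ 2
    have h2 : 0 ≤ ∫ t, (∑ i ∈ Finset.range (M + 1), (-1) ^ i / B ^ i ^ 2 * t ^ i) ^ 2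
        ∂hF.stieltjesFunction.measure := integral_nonneg fun t => sq_nonneg _
    have h3 := alternatingRatioSeq_quadraticForm_le hd hB M
    rw [h1] at h2
    have h4 : (M : ℝ) * (2 / d - 1) = 2 * (M / d) - M := by ring
    linarith

theorem mainTheorem9 :
    (∀ s : ℕ → ℝ, (∀ n : ℕ, 0 < s n) →
      (∀ n : ℕ, 1 ≤ n → s (n - 1) * s (n + 1) ≥ 4 * s n ^ 2) →
      IsHamburgerMomentSequence s) ∧
    (∀ c : ℝ, c < 4 →
      ∃ s : ℕ → ℝ, (∀ n : ℕ, 0 < s n) ∧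
        (∀ n : ℕ, 1 ≤ n → s (n - 1) * s (n + 1) ≥ c * s n ^ 2) ∧
        ¬ IsHamburgerMomentSequence s) := by
  refine ⟨fun s hs h4 => isHamburgerMomentSequence_of_four_mul_sq_le hs fun n =>
    h4 (n + 1) (by omega), fun c hc => ?_⟩
  obtain ⟨s, hs, hsc, hnot⟩ := exists_not_isHamburgerMomentSequence hc
  refine ⟨s, hs, fun n hn => ?_, hnot⟩
  obtain ⟨m, rfl⟩ : ∃ m, n = m + 1 := ⟨n - 1, by omega⟩
  exact hsc m
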